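/- Let $d$ and $n$ be positive integers. The cells of the $d$-dimensional $n^d$ board are the points of $\{1,\dots,n\}^d$, and two distinct cells $c, c'$ are neighbours if $|c_i-c'_i|\le 1$ for every $i=1,\dots,d$. Suppose that the cells can be filled with integers, not all of them zero, in such a way that the entry of every cell equals the sum of the entries of its neighbouring cells. Then $3\mid n+1$. -/

import Mathlib

/-- The graph of neighbouring cells of the `d`-dimensional `n × ⋯ × n` board. The cells are the
points of `Fin d → Fin n`, and two distinct cells are neighbours when the corresponding unit cubes
touch (at least in a common vertex), that is, when all their coordinates differ by at most `1`.
For `d = 2` this is the king's graph. -/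
def boardGraph (d n : ℕ) : SimpleGraph (Fin d → Fin n) where
  Adj c c' := c ≠ c' ∧ ∀ i, |((c i : ℕ) : ℤ) - ((c' i : ℕ) : ℤ)| ≤ 1
  symm := ⟨fun _ _ h => ⟨h.1.symm, fun i => by rw [abs_sub_comm]; exact h.2 i⟩⟩
  loopless := ⟨fun _ h => h.1 rfl⟩

instance boardGraph.decidableAdj (d n : ℕ) : DecidableRel (boardGraph d n).Adj :=
  fun c c' => inferInstanceAs
    (Decidable (c ≠ c' ∧ ∀ i, |((c i : ℕ) : ℤ) - ((c' i : ℕ) : ℤ)| ≤ 1))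

/-- The filling `x` of the board with integers has the neighbour-sum property: every entry is the
sum of the entries of the neighbouring cells. -/
def NeighbourSum {d n : ℕ} (x : (Fin d → Fin n) → ℤ) : Prop :=
  ∀ c, x c = ∑ c' ∈ (boardGraph d n).neighborFinset c, x c'

/-! Adding `x c` to both sides, the sum over the closed neighbourhood of `c` is `2 * x c`, which
vanishes mod 2. The closed-neighbourhood sum factors coordinatewise into path sums, each injective
over any abelian group when `¬ 3 ∣ n + 1`. So every entry is even; halving preserves `NeighbourSum`,
and descent makes the filling zero. -/

/-- A sequence with `g i + g (i + 1) + g (i + 2) = 0` for `i < n` is `3`-periodic up to `n + 1`. -/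
theorem eq_of_add_add_eq_zero {M : Type*} [AddCommGroup M] {n : ℕ} {g : ℕ → M} (h0 : g 0 = 0)
    (hg : ∀ i < n, g i + g (i + 1) + g (i + 2) = 0) (i : ℕ) (hi : i ≤ n + 1) :
    g i = if i % 3 = 0 then 0 else if i % 3 = 1 then g 1 else -g 1 := by
  induction i using Nat.strong_induction_on with
  | _ i ih =>
    match i with
    | 0 => simpa using h0
    | 1 => simp
    | i + 2 =>
      have h := hg i (by omega)
      rw [ih i (by omega) (by omega), ih (i + 1) (by omega) (by omega)] at h
      have hlt : i % 3 < 3 := Nat.mod_lt _ (by norm_num)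
      rw [Nat.add_mod i 1] at h
      rw [Nat.add_mod i 2]
      interval_cases i % 3 <;> simp at h ⊢
      · exact eq_neg_of_add_eq_zero_right h
      · exact h
      · exact (neg_add_eq_zero.mp h).symm

/-- As `n + 1` is not divisible by 3, `g (n + 1)` is `g 1` or `-g 1`. -/
theorem eq_zero_of_add_add_eq_zero {M : Type*} [AddCommGroup M] {n : ℕ} (hn : ¬ 3 ∣ n + 1)
    {g : ℕ → M} (h0 : g 0 = 0) (hlast : g (n + 1) = 0)
    (hg : ∀ i < n, g i + g (i + 1) + g (i + 2) = 0) (i : ℕ) (hi : i ≤ n + 1) : g i = 0 := by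
  have h1 : g 1 = 0 := by
    have h := eq_of_add_add_eq_zero h0 hg (n + 1) le_rfl
    rw [hlast, if_neg (by omega)] at h
    split_ifs at h
    · exact h.symm
    · exact neg_eq_zero.mp h.symm
  rw [eq_of_add_add_eq_zero h0 hg i hi, h1]
  simp

/-- The closed-neighbourhood sum on a path with `n` vertices is injective unless `3 ∣ n + 1`. -/
theorem eq_zero_of_path_sum_eq_zero {M : Type*} [AddCommGroup M] {n : ℕ} (hn : ¬ 3 ∣ n + 1)
    (f : Fin n → M)
    (hf : ∀ a : Fin n, ∑ b ∈ Finset.univ.filter fun b : Fin n => |((a : ℕ) : ℤ) - ((b : ℕ) : ℤ)| ≤ 1, f b = 0) : f = 0 := by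
  -- Shifting by one and padding with zeros at `0` and `n + 1` gives the end vertices the same
  -- recurrence.
  let g : ℕ → M := fun i => if h : 0 < i ∧ i - 1 < n then f ⟨i - 1, h.2⟩ else 0
  have h0 : g 0 = 0 := by simp [g]
  have hlast : g (n + 1) = 0 := by simp [g]
  have hgf (b : Fin n) : g (b + 1) = f b := by simp [g]
  have hg : ∀ i < n, g i + g (i + 1) + g (i + 2) = 0 := by
    intro i hi
    rw [← hf ⟨i, hi⟩]
    have h3 : ∑ j ∈ Finset.range (n + 2), (if j ∈ ({i, i + 1, i + 2} : Finset ℕ) then g j else 0)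
        = g i + g (i + 1) + g (i + 2) := by
      rw [← Finset.sum_filter, Finset.filter_mem_eq_inter, Finset.inter_eq_right.mpr]
      · rw [Finset.sum_insert (by simp), Finset.sum_insert (by simp), Finset.sum_singleton,
          add_assoc]
      · intro j
        simp only [Finset.mem_insert, Finset.mem_singleton, Finset.mem_range]
        omega
    rw [← h3, Finset.sum_range_succ, Finset.sum_range_succ', h0, hlast, ite_self, ite_self,
      add_zero, add_zero, Finset.sum_filter, ← Fin.sum_univ_eq_sum_range
        (fun j => if j + 1 ∈ ({i, i + 1, i + 2} : Finset ℕ) then g (j + 1) else 0)]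
    refine Finset.sum_congr rfl fun b _ => ?_
    rw [hgf]
    congr 1
    simp only [Finset.mem_insert, Finset.mem_singleton, abs_le, eq_iff_iff]
    omega
  funext b
  rw [← hgf b]
  exact eq_zero_of_add_add_eq_zero hn h0 hlast hg _ (by omega)

/-- The closed-neighbourhood sum on the board is injective unless `3 ∣ n + 1`. -/
theorem eq_zero_of_board_sum_eq_zero {M : Type*} [AddCommGroup M] {n : ℕ} (hn : ¬ 3 ∣ n + 1)
    (d : ℕ) (x : (Fin d → Fin n) → M)
    (hx : ∀ c : Fin d → Fin n,
      ∑ c' with ∀ i, |((c i : ℕ) : ℤ) - ((c' i : ℕ) : ℤ)| ≤ 1, x c' = 0) : x = 0 := by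
  induction d with
  | zero =>
    funext c
    simpa [Subsingleton.elim default c] using hx c
  | succ d ih =>
    -- Path sums in the first coordinate satisfy the hypothesis in dimension `d`.
    have hy (a : Fin n) : (fun c : Fin d → Fin n =>
        ∑ b ∈ Finset.univ.filter fun b : Fin n => |((a : ℕ) : ℤ) - ((b : ℕ) : ℤ)| ≤ 1, x (Fin.cons b c)) = 0 := by
      refine ih _ fun c => ?_
      rw [← hx (Fin.cons a c), Finset.sum_comm]
      simp only [Finset.sum_filter]
      rw [← (Fin.consEquiv fun _ : Fin (d + 1) => Fin n).sum_comp, Fintype.sum_prod_type]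
      refine Finset.sum_congr rfl fun b _ => ?_
      by_cases hb : |((a : ℕ) : ℤ) - ((b : ℕ) : ℤ)| ≤ 1 <;>
        simp [Fin.consEquiv, Fin.forall_fin_succ, hb]
    funext c
    have := eq_zero_of_path_sum_eq_zero hn (fun b => x (Fin.cons b (Fin.tail c)))
      fun a => congrFun (hy a) (Fin.tail c)
    simpa using congrFun this (c 0)

theorem NeighbourSum.sum_eq_two_mul {d n : ℕ} {x : (Fin d → Fin n) → ℤ} (hx : NeighbourSum x)
    (c : Fin d → Fin n) :
    ∑ c' with ∀ i, |((c i : ℕ) : ℤ) - ((c' i : ℕ) : ℤ)| ≤ 1, x c' = 2 * x c := by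
  have h : (Finset.univ.filter fun c' : Fin d → Fin n =>
      ∀ i, |((c i : ℕ) : ℤ) - ((c' i : ℕ) : ℤ)| ≤ 1)
      = insert c ((boardGraph d n).neighborFinset c) := by
    ext c'
    simp only [Finset.mem_filter, Finset.mem_univ, true_and, Finset.mem_insert,
      SimpleGraph.mem_neighborFinset]
    constructor
    · intro h
      by_cases hc : c' = c
      · exact Or.inl hc
      · exact Or.inr ⟨Ne.symm hc, h⟩
    · rintro (rfl | h)
      · simp
      · exact h.2
  rw [h, Finset.sum_insert (by simp), ← hx c, two_mul]

theorem NeighbourSum.two_dvd {d n : ℕ} (hn : ¬ 3 ∣ n + 1) {x : (Fin d → Fin n) → ℤ}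
    (hx : NeighbourSum x) (c : Fin d → Fin n) : 2 ∣ x c := by
  have h : (fun c => (x c : ZMod 2)) = 0 := by
    refine eq_zero_of_board_sum_eq_zero hn d _ fun c => ?_
    rw [← Int.cast_sum, hx.sum_eq_two_mul]
    exact (ZMod.intCast_zmod_eq_zero_iff_dvd _ 2).mpr (dvd_mul_right _ _)
  exact (ZMod.intCast_zmod_eq_zero_iff_dvd _ 2).mp (congrFun h c)

theorem NeighbourSum.two_pow_dvd {d n : ℕ} (hn : ¬ 3 ∣ n + 1) (k : ℕ)
    {x : (Fin d → Fin n) → ℤ} (hx : NeighbourSum x) (c : Fin d → Fin n) : 2 ^ k ∣ x c := by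
  induction k generalizing x with
  | zero => simp
  | succ k ih =>
    choose y hy using hx.two_dvd hn
    have hNy : NeighbourSum y := by
      intro c
      have h := hx c
      simp only [hy, ← Finset.mul_sum] at h
      exact mul_left_cancel₀ two_ne_zero h
    rw [hy c, pow_succ']
    exact mul_dvd_mul_left 2 (ih hNy)

theorem mainTheorem6 (d n : ℕ)
    (h : ∃ x : (Fin d → Fin n) → ℤ, x ≠ 0 ∧ NeighbourSum x) :
    3 ∣ n + 1 := by
  obtain ⟨x, hx0, hx⟩ := h
  by_contra hn
  refine hx0 (funext fun c => ?_)
  -- The exponent `|x c|` suffices, since `m < 2 ^ m`.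
  refine Int.eq_zero_of_abs_lt_dvd (hx.two_pow_dvd hn (x c).natAbs c) ?_
  rw [Int.abs_eq_natAbs]
  exact_mod_cast Nat.lt_two_pow_self
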